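/- Let $\mathcal B$ be a Krull--Schmidt exact category (in the sense of Quillen) with enough projectives and enough injectives; here Krull--Schmidt means that $\mathcal B$ is additive and every object is a finite direct sum of objects with local endomorphism rings. A \emph{cotorsion pair} on $\mathcal B$ is a pair $(\mathcal U,\mathcal V)$ of full additive subcategories closed under direct summands such that $\operatorname{Ext}^1_{\mathcal B}(U,V)=0$ for all $U\in\mathcal U$, $V\in\mathcal V$, and such that every $B\in\mathcal B$ admits short exact sequences $V_B\rightarrowtail U_B\twoheadrightarrow B$ and $B\rightarrowtail V^B\twoheadrightarrow U^B$ with $U_B,U^B\in\mathcal U$ and $V_B,V^B\in\mathcal V$. A \emph{twin cotorsion pair} is a pair of cotorsion pairs $(\mathcal S,\mathcal T),(\mathcal U,\mathcal V)$ with $\mathcal S\subseteq\mathcal U$. Put $\mathcal W=\mathcal T\cap\mathcal U$. Let $\mathcal B^+$ be the full subcategory of the objects $B$ that admit a short exact sequence $V\rightarrowtail W\twoheadrightarrow B$ with $V\in\mathcal V$, $W\in\mathcal W$, let $\mathcal B^-$ be the full subcategory of the objects $B$ that admit a short exact sequence $B\rightarrowtail W\twoheadrightarrow S$ with $W\in\mathcal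 W$, $S\in\mathcal S$, and let $\mathcal H=\mathcal B^+\cap\mathcal B^-$. The \emph{heart} is $\underline{\mathcal H}=\mathcal H/\mathcal W$, the category with the objects of $\mathcal H$ and with morphisms those of $\mathcal B$ modulo the morphisms that factor through an object of $\mathcal W$. Theorem. For every twin cotorsion pair $(\mathcal S,\mathcal T),(\mathcal U,\mathcal V)$ on $\mathcal B$, the heart $\underline{\mathcal H}$ is semi-abelian in the sense of Rump. That is, $\underline{\mathcal H}$ is preabelian (additive, and every morphism has a kernel and a cokernel), and for every commutative square $$\begin{array}{ccc} A & \xrightarrow{\ \alpha\ } & B\\ {\scriptstyle\beta}\downarrow & & \downarrow{\scriptstyle\gamma}\\ C & \xrightarrow{\ \delta\ } & D\end{array}$$ in $\underline{\mathcal H}$: if the square is a pull-back and $\delta$ is a cokernel of some morphism, then $\alpha$ is an epimorphism; and if the square is a push-out and $\alpha$ is a kernel of some morphism, then $\delta$ is a monomorphism. -/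

import Mathlib

open CategoryTheory CategoryTheory.Limits

universe v u

namespace ExactHeart

section Basic

variable {C : Type u} [Category.{v} C]

/-- The composable pair `(i, d)` is a weak short exact sequence: `i` is a kernel of `d`
and `d` is a cokernel of `i`. -/
def IsWeakShortExact [Preadditive C] (S : ShortComplex C) : Prop :=
  Nonempty (IsLimit (KernelFork.ofι S.f S.zero)) ∧
    Nonempty (IsColimit (CokernelCofork.ofπ S.g S.zero))

/-- The direct sum of two composable pairs. -/
noncomputable def directSum [Preadditive C] [HasBinaryBiproducts C] (S S' : ShortComplex C) :
    ShortComplex C :=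
  ShortComplex.mk (biprod.map S.f S'.f) (biprod.map S.g S'.g) (by ext <;> simp)

/-- `X` is a finite direct sum of objects with local endomorphism rings, for every `X`. -/
def IsKrullSchmidt (C : Type u) [Category.{v} C] [Preadditive C] : Prop :=
  ∀ X : C, ∃ (n : ℕ) (Y : Fin n → C) (b : Bicone Y),
    (∀ i, IsLocalRing (End (Y i))) ∧ Nonempty b.IsBilimit ∧ Nonempty (X ≅ b.pt)

/-- `f` is a kernel of some morphism. -/
def IsAKernel [HasZeroMorphisms C] {X Y : C} (f : X ⟶ Y) : Prop :=
  ∃ (Z : C) (g : Y ⟶ Z) (w : f ≫ g = 0), Nonempty (IsLimit (KernelFork.ofι f w))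

/-- `f` is a cokernel of some morphism. -/
def IsACokernel [HasZeroMorphisms C] {X Y : C} (f : X ⟶ Y) : Prop :=
  ∃ (Z : C) (g : Z ⟶ X) (w : g ≫ f = 0), Nonempty (IsColimit (CokernelCofork.ofπ f w))

/-- Preabelian category: an additive category in which every morphism has a kernel and a
cokernel. -/
structure IsPreabelian (A : Type u) [Category.{v} A] [Preadditive A] : Prop where
  hasZeroObject : HasZeroObject A
  hasBinaryBiproducts : HasBinaryBiproducts A
  hasKernels : HasKernels A
  hasCokernels : HasCokernels A

/-- Left semi-abelian category: preabelian, and base changes of cokernels are epimorphisms. -/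
structure IsLeftSemiAbelian (A : Type u) [Category.{v} A] [Preadditive A] : Prop
    extends IsPreabelian A where
  epi_of_isPullback : ∀ {X Y Z W : A} (α : X ⟶ Y) (β : X ⟶ Z) (γ : Y ⟶ W) (δ : Z ⟶ W),
    IsPullback α β γ δ → IsACokernel δ → Epi α

/-- Right semi-abelian category: preabelian, and cobase changes of kernels are
monomorphisms. -/
structure IsRightSemiAbelian (A : Type u) [Category.{v} A] [Preadditive A] : Prop
    extends IsPreabelian A where
  mono_of_isPushout : ∀ {X Y Z W : A} (α : X ⟶ Y) (β : X ⟶ Z) (γ : Y ⟶ W) (δ : Z ⟶ W),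
    IsPushout α β γ δ → IsAKernel α → Mono δ

/-- Semi-abelian category in the sense of Rump. -/
structure IsSemiAbelian (A : Type u) [Category.{v} A] [Preadditive A] : Prop where
  left : IsLeftSemiAbelian A
  right : IsRightSemiAbelian A

/-- `i` is an inflation for the class `E`: the first morphism of a pair in `E`. -/
def IsInflation [Preadditive C] (E : ShortComplex C → Prop) {X Y : C} (i : X ⟶ Y) : Prop :=
  ∃ (Z : C) (d : Y ⟶ Z) (w : i ≫ d = 0), E (ShortComplex.mk i d w)

/-- `d` is a deflation for the class `E`: the second morphism of a pair in `E`. -/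
def IsDeflation [Preadditive C] (E : ShortComplex C → Prop) {Y Z : C} (d : Y ⟶ Z) : Prop :=
  ∃ (X : C) (i : X ⟶ Y) (w : i ≫ d = 0), E (ShortComplex.mk i d w)

end Basic

/-- A Quillen exact structure on an additive category: a class of weak short exact sequences
(called the short exact sequences), stable under isomorphisms, direct sums and direct
summands, with the usual axioms on inflations and deflations. -/
structure ExactStructure (C : Type u) [Category.{v} C] [Preadditive C] [HasZeroObject C]
    [HasBinaryBiproducts C] where
  /-- The short exact sequences. -/
  Conflation : ShortComplex C → Prop
  isWeakShortExact : ∀ S, Conflation S → IsWeakShortExact S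
  of_iso : ∀ S S', Nonempty (S ≅ S') → Conflation S → Conflation S'
  directSum_mem : ∀ S S', Conflation S → Conflation S' → Conflation (directSum S S')
  of_directSum : ∀ S S', Conflation (directSum S S') → Conflation S
  id_inflation : ∀ X : C, IsInflation Conflation (𝟙 X)
  id_deflation : ∀ X : C, IsDeflation Conflation (𝟙 X)
  comp_inflation : ∀ {X Y Z : C} (f : X ⟶ Y) (g : Y ⟶ Z),
    IsInflation Conflation f → IsInflation Conflation g → IsInflation Conflation (f ≫ g)
  comp_deflation : ∀ {X Y Z : C} (f : X ⟶ Y) (g : Y ⟶ Z),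
    IsDeflation Conflation f → IsDeflation Conflation g → IsDeflation Conflation (f ≫ g)
  pullback_deflation : ∀ {Y Z Z' : C} (d : Y ⟶ Z) (f : Z' ⟶ Z), IsDeflation Conflation d →
    ∃ (Y' : C) (f' : Y' ⟶ Y) (d' : Y' ⟶ Z'), IsPullback f' d' d f ∧ IsDeflation Conflation d'
  pushout_inflation : ∀ {X X' Y : C} (i : X ⟶ Y) (g : X ⟶ X'), IsInflation Conflation i →
    ∃ (Y' : C) (g' : Y ⟶ Y') (i' : X' ⟶ Y'), IsPushout i g g' i' ∧ IsInflation Conflation i'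

section Heart

open scoped ZeroObject

variable {C : Type u} [Category.{v} C] [Preadditive C] [HasZeroObject C] [HasBinaryBiproducts C]

namespace ExactStructure

variable (E : ExactStructure C)

/-- Projective objects of an exact category: lifting along deflations. -/
def IsProjective (P : C) : Prop :=
  ∀ ⦃X Y : C⦄ (f : X ⟶ Y) (g : P ⟶ Y), IsDeflation E.Conflation f → ∃ h : P ⟶ X, h ≫ f = g

/-- Injective objects of an exact category: extension along inflations. -/
def IsInjective (I : C) : Prop :=
  ∀ ⦃X Y : C⦄ (f : X ⟶ Y) (g : X ⟶ I), IsInflation E.Conflation f → ∃ h : Y ⟶ I, f ≫ h = g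

def EnoughProjectives : Prop :=
  ∀ X : C, ∃ (P : C) (p : P ⟶ X), E.IsProjective P ∧ IsDeflation E.Conflation p

def EnoughInjectives : Prop :=
  ∀ X : C, ∃ (I : C) (i : X ⟶ I), E.IsInjective I ∧ IsInflation E.Conflation i

/-- There is a short exact sequence `X ↣ Y ↠ Z` on the given objects. -/
def HasConflation (X Y Z : C) : Prop :=
  ∃ (i : X ⟶ Y) (d : Y ⟶ Z) (w : i ≫ d = 0), E.Conflation (ShortComplex.mk i d w)

/-- An extension of `Z` by `X`: a short exact sequence `X ↣ mid ↠ Z`. -/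
structure Extension (Z X : C) where
  mid : C
  i : X ⟶ mid
  d : mid ⟶ Z
  w : i ≫ d = 0
  conflation : E.Conflation (ShortComplex.mk i d w)

/-- Yoneda equivalence of extensions: an isomorphism of the middle terms that is compatible
with the identities of the end terms. -/
def extensionSetoid (Z X : C) : Setoid (E.Extension Z X) where
  r A B := ∃ e : A.mid ≅ B.mid, A.i ≫ e.hom = B.i ∧ e.hom ≫ B.d = A.d
  iseqv :=
    { refl := fun A => ⟨Iso.refl _, by simp, by simp⟩
      symm := by
        rintro A B ⟨e, h₁, h₂⟩
        exact ⟨e.symm, by simp [← h₁], by simp [← h₂]⟩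
      trans := by
        rintro A B D ⟨e, h₁, h₂⟩ ⟨e', h₃, h₄⟩
        exact ⟨e ≪≫ e', by simp [← h₃, ← h₁], by simp [← h₂, ← h₄]⟩ }

/-- The set of Yoneda classes of extensions of `Z` by `X`. It always contains the class of the
split extension (the zero element), so it vanishes exactly if it is a subsingleton. -/
def Ext1 (Z X : C) : Type (max u v) := Quotient (E.extensionSetoid Z X)

/-- Full additive subcategories closed under direct summands (in particular, under
isomorphisms). -/
structure IsAdditiveSubcategory (P : ObjectProperty C) : Prop where
  zero : P (0 : C)
  biprod : ∀ X Y, P X → P Y → P (X ⊞ Y)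
  summand : ∀ X Y Z, P Z → Nonempty (Z ≅ X ⊞ Y) → P X

/-- `(U, V)` is a cotorsion pair. -/
structure IsCotorsionPair (U V : ObjectProperty C) : Prop where
  left : IsAdditiveSubcategory U
  right : IsAdditiveSubcategory V
  ext_eq_zero : ∀ X Y, U X → V Y → Subsingleton (E.Ext1 X Y)
  resolution : ∀ B : C, ∃ X Y, U X ∧ V Y ∧ E.HasConflation Y X B
  coresolution : ∀ B : C, ∃ X Y, U X ∧ V Y ∧ E.HasConflation B Y X

/-- A twin cotorsion pair `(S, T), (U, V)`. -/
structure TwinCotorsionPair where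
  (S T U V : ObjectProperty C)
  cotorsion_ST : E.IsCotorsionPair S T
  cotorsion_UV : E.IsCotorsionPair U V
  le : S ≤ U

end ExactStructure

namespace ExactStructure.TwinCotorsionPair

variable {E : ExactStructure C} (P : E.TwinCotorsionPair)

/-- `W = T ∩ U`. -/
def W : ObjectProperty C := P.T ⊓ P.U

/-- The objects `B` with a short exact sequence `V ↣ W ↠ B`. -/
def Bplus : ObjectProperty C := fun B => ∃ X Y, P.W X ∧ P.V Y ∧ E.HasConflation Y X B

/-- The objects `B` with a short exact sequence `B ↣ W ↠ S`. -/
def Bminus : ObjectProperty C := fun B => ∃ X Y, P.W X ∧ P.S Y ∧ E.HasConflation B X Y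

/-- `H`, the intersection of `Bplus` and `Bminus`. -/
def H : ObjectProperty C := P.Bplus ⊓ P.Bminus

/-- Two parallel morphisms are identified if their difference factors through `W`. -/
def rel : HomRel C := fun X Y f g =>
  ∃ (Z : C) (_ : P.W Z) (a : X ⟶ Z) (b : Z ⟶ Y), f - g = a ≫ b

theorem rel_add {X Y : C} (f₁ f₂ g₁ g₂ : X ⟶ Y) (hf : P.rel f₁ f₂) (hg : P.rel g₁ g₂) :
    P.rel (f₁ + g₁) (f₂ + g₂) := by
  obtain ⟨Z, hZ, a, b, h⟩ := hf
  obtain ⟨Z', hZ', a', b', h'⟩ := hg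
  refine ⟨Z ⊞ Z', ⟨P.cotorsion_ST.right.biprod _ _ hZ.1 hZ'.1,
    P.cotorsion_UV.left.biprod _ _ hZ.2 hZ'.2⟩, biprod.lift a a', biprod.desc b b', ?_⟩
  rw [biprod.lift_desc, ← h, ← h']
  abel

instance congruence_rel : Congruence P.rel where
  comp_left := by
    rintro X Y Z f g g' ⟨A, hA, a, b, h⟩
    exact ⟨A, hA, f ≫ a, b, by rw [← Preadditive.comp_sub, h, Category.assoc]⟩
  comp_right := by
    rintro X Y Z f f' g ⟨A, hA, a, b, h⟩
    exact ⟨A, hA, a, b ≫ g, by rw [← Preadditive.sub_comp, h, Category.assoc]⟩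
  equivalence :=
    { refl := fun f =>
        ⟨(0 : C), ⟨P.cotorsion_ST.right.zero, P.cotorsion_UV.left.zero⟩, 0, 0, by simp⟩
      symm := by
        rintro f g ⟨A, hA, a, b, h⟩
        exact ⟨A, hA, a, -b, by rw [Preadditive.comp_neg, ← h, neg_sub]⟩
      trans := by
        rintro f g k hf hg
        obtain ⟨A, hA, a, b, h⟩ := P.rel_add _ _ _ _ hf hg
        exact ⟨A, hA, a, b, by rw [← h]; abel⟩ }

/-- The quotient category `B/W`. -/
abbrev StableCategory := CategoryTheory.Quotient P.rel

instance : Preadditive P.StableCategory :=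
  CategoryTheory.Quotient.preadditive P.rel (fun _ _ f₁ f₂ g₁ g₂ hf hg => P.rel_add f₁ f₂ g₁ g₂ hf hg)

/-- The objects of `B/W` that come from `H`. -/
def heartProperty : ObjectProperty P.StableCategory := fun X => P.H X.as

/-- The heart `H/W`: the full subcategory of `B/W` on the objects of `H`. -/
abbrev Heart := P.heartProperty.FullSubcategory

end ExactStructure.TwinCotorsionPair

end Heart

end ExactHeart

/-! Two facts about inflations with cokernel in `S` carry the argument. One is that they are
epimorphisms modulo `W` as tested on `Bplus` (`null_of_ses_comp`): a map into `W ⊆ T` extends along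
them, and the remaining difference factors through an object of `S ⊆ U`, so it lifts through the
object of `W` that covers the target with kernel in `V`. The other is that every object has such an
inflation into `Bplus` through which all its maps to `Bplus` factor (`exists_reflection`).

The cokernel of `f : A ⟶ B` in the heart comes from pushing `f` out along `A ↣ W` and reflecting the
pushout into `Bplus`. The composite `c : B ↣ D` is an inflation with cokernel in `S`, since `S` is
closed under extensions. Its base change along `γ : B' ⟶ D` can be imitated in the exact category:
once `γ` is enlarged to a deflation from `B' ⊞ W`, the kernel of `B' ⊞ W ↠ D ↠ S` again includes by
an inflation with cokernel in `S`, hence by an epimorphism modulo `W` (`isStablyEpi_of_ses`). The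
reflection of this kernel gives a square in the heart, which maps to any true pullback, so the
pullback projection is an epimorphism.

Everything else is dual: in the opposite category `(V, U), (T, S)` is a twin cotorsion pair, with
`Bplus` and `Bminus` exchanged. -/

namespace ExactHeart

variable {C : Type u} [Category.{v} C] [Preadditive C] [HasBinaryBiproducts C]

namespace ExactStructure

open scoped ZeroObject

/-! ### Direct sums in the opposite category. -/

/-- Biproducts commute with passage to the opposite category. -/
noncomputable def unopBiprodIso (X Y : Cᵒᵖ) : (X ⊞ Y).unop ≅ X.unop ⊞ Y.unop where
  hom := biprod.lift (biprod.inl : X ⟶ X ⊞ Y).unop (biprod.inr : Y ⟶ X ⊞ Y).unop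
  inv := biprod.desc (biprod.fst : X ⊞ Y ⟶ X).unop (biprod.snd : X ⊞ Y ⟶ Y).unop
  hom_inv_id := by
    rw [biprod.lift_desc, ← unop_comp, ← unop_comp, ← unop_add, biprod.total, unop_id]
  inv_hom_id := by ext <;> simp [← unop_comp]

/-- The direct sum of short complexes commutes with passage to the opposite category. -/
theorem nonempty_directSum_unop_iso (S S' : ShortComplex Cᵒᵖ) :
    Nonempty ((directSum S S').unop ≅ directSum S.unop S'.unop) := by
  have he {X X' Y Y' : Cᵒᵖ} (f : X ⟶ Y) (f' : X' ⟶ Y') :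
      (unopBiprodIso Y Y').hom ≫ biprod.map f.unop f'.unop =
        (biprod.map f f').unop ≫ (unopBiprodIso X X').hom := by
    ext <;> simp [unopBiprodIso, ← unop_comp]
  exact ⟨ShortComplex.isoMk (unopBiprodIso _ _) (unopBiprodIso _ _) (unopBiprodIso _ _)
    (he S.g S'.g) (he S.f S'.f)⟩

variable [HasZeroObject C]

/-! ### Calculus of short exact sequences. -/

/-- The composable pair `(i, d)` is a short exact sequence. -/
def SES (E : ExactStructure C) {X Y Z : C} (i : X ⟶ Y) (d : Y ⟶ Z) : Prop :=
  ∃ w : i ≫ d = 0, E.Conflation (ShortComplex.mk i d w)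

variable {E : ExactStructure C}

namespace SES

variable {X Y Z : C} {i : X ⟶ Y} {d : Y ⟶ Z}

theorem zero (h : E.SES i d) : i ≫ d = 0 := h.1

theorem exists_lift (h : E.SES i d) {T : C} (g : T ⟶ Y) (w : g ≫ d = 0) : ∃ l, l ≫ i = g := by
  obtain ⟨⟨hl⟩, -⟩ := E.isWeakShortExact _ h.2
  obtain ⟨l, hl⟩ := KernelFork.IsLimit.lift' hl g w
  exact ⟨l, hl⟩

theorem exists_desc (h : E.SES i d) {T : C} (g : Y ⟶ T) (w : i ≫ g = 0) : ∃ l, d ≫ l = g := by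
  obtain ⟨-, ⟨hl⟩⟩ := E.isWeakShortExact _ h.2
  obtain ⟨l, hl⟩ := CokernelCofork.IsColimit.desc' hl g w
  exact ⟨l, hl⟩

theorem mono (h : E.SES i d) : Mono i := by
  obtain ⟨⟨hl⟩, -⟩ := E.isWeakShortExact _ h.2
  exact mono_of_isLimit_fork hl

theorem epi (h : E.SES i d) : Epi d := by
  obtain ⟨-, ⟨hl⟩⟩ := E.isWeakShortExact _ h.2
  exact epi_of_isColimit_cofork hl

theorem inflation (h : E.SES i d) : IsInflation E.Conflation i := ⟨_, d, h⟩

theorem deflation (h : E.SES i d) : IsDeflation E.Conflation d := ⟨_, i, h⟩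

theorem of_iso (h : E.SES i d) {X' Y' Z' : C} {i' : X' ⟶ Y'} {d' : Y' ⟶ Z'} (a : X ≅ X')
    (b : Y ≅ Y') (c : Z ≅ Z') (h₁ : a.hom ≫ i' = i ≫ b.hom) (h₂ : b.hom ≫ d' = d ≫ c.hom) :
    E.SES i' d' := by
  have w : i' ≫ d' = 0 := by
    rw [← cancel_epi a.hom, reassoc_of% h₁, h₂, reassoc_of% h.zero]
    simp
  exact ⟨w, E.of_iso _ _ ⟨ShortComplex.isoMk a b c h₁ h₂⟩ h.2⟩

/-- Cokernels are unique up to isomorphism, so any cokernel of an inflation completes it. -/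
theorem of_inflation (hi : IsInflation E.Conflation i) (w : i ≫ d = 0) [Epi d]
    (h : ∀ {T : C} (g : Y ⟶ T), i ≫ g = 0 → ∃ l, d ≫ l = g) : E.SES i d := by
  obtain ⟨Q, q, hq⟩ := hi
  have hq : E.SES i q := hq
  have := hq.epi
  obtain ⟨a, ha⟩ := hq.exists_desc d w
  obtain ⟨b, hb⟩ := h q hq.zero
  refine hq.of_iso (Iso.refl _) (Iso.refl _) ⟨a, b, ?_, ?_⟩ (by simp) (by simp [ha])
  · rw [← cancel_epi q, reassoc_of% ha, hb, Category.comp_id]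
  · rw [← cancel_epi d, reassoc_of% hb, ha, Category.comp_id]

theorem pushout (h : E.SES i d) {X' Y' : C} {g : X ⟶ X'} {g' : Y ⟶ Y'} {i' : X' ⟶ Y'}
    (sq : IsPushout i g g' i') : ∃ d', E.SES i' d' ∧ g' ≫ d' = d := by
  -- The axiom gives an inflation in some pushout; it is transported to the given one.
  have hi : IsInflation E.Conflation i' := by
    obtain ⟨Q, p, j, sq', ⟨R, q, hq⟩⟩ := E.pushout_inflation i g h.inflation
    have hq : E.SES j q := hq
    let e := sq'.isoIsPushout _ _ sq
    exact (hq.of_iso (Iso.refl _) e (Iso.refl _) (d' := e.inv ≫ q)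
      (by simp [e]) (by simp)).inflation
  refine ⟨sq.desc d 0 (by simp [h.zero]), ?_, by simp⟩
  have := h.epi
  have : Epi (sq.desc d 0 (by simp [h.zero])) := by
    have : Epi (g' ≫ sq.desc d 0 (by simp [h.zero])) := by simpa
    exact epi_of_epi g' _
  refine of_inflation hi (by simp) fun k hk => ?_
  obtain ⟨l, hl⟩ := h.exists_desc (g' ≫ k) (by rw [sq.w_assoc, hk, comp_zero])
  exact ⟨l, sq.hom_ext (by simpa) (by simp [hk])⟩

/-- The third isomorphism theorem for a composition of two inflations. -/
theorem comp (h : E.SES i d) {M N : C} {j : Y ⟶ M} {e : M ⟶ N} (h' : E.SES j e) :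
    ∃ (Q : C) (p : M ⟶ Q) (k : Z ⟶ Q) (q : Q ⟶ N),
      E.SES (i ≫ j) p ∧ E.SES k q ∧ p ≫ q = e ∧ IsPushout d j k p := by
  obtain ⟨Q, p, k, sq, -⟩ := E.pushout_inflation j d h'.inflation
  obtain ⟨q, hq, hpq⟩ := h'.pushout sq
  refine ⟨Q, p, k, q, ?_, hq, hpq, sq.flip⟩
  have := h.epi
  have : Epi p := ⟨fun a b hab => sq.hom_ext hab (by
    rw [← cancel_epi d, ← sq.w_assoc, ← sq.w_assoc, hab])⟩
  refine of_inflation (E.comp_inflation _ _ h.inflation h'.inflation) ?_ fun g hg => ?_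
  · rw [Category.assoc, sq.w, reassoc_of% h.zero, zero_comp]
  · obtain ⟨l, hl⟩ := h.exists_desc (j ≫ g) (by simpa using hg)
    exact ⟨sq.desc g l hl.symm, by simp⟩

theorem biprod (h : E.SES i d) {X' Y' Z' : C} {i' : X' ⟶ Y'} {d' : Y' ⟶ Z'} (h' : E.SES i' d') :
    E.SES (biprod.map i i') (biprod.map d d') :=
  ⟨_, E.directSum_mem _ _ h.2 h'.2⟩

end SES

variable (E) in
theorem ses_id (X : C) : E.SES (𝟙 X) (0 : X ⟶ 0) := by
  refine SES.of_inflation (E.id_inflation X) (by simp) fun g hg => ⟨0, ?_⟩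
  rw [Category.id_comp] at hg
  simp [hg]

/-! ### The opposite exact structure and base change. -/

variable (E) in
/-- The opposite exact structure. -/
noncomputable def op : ExactStructure Cᵒᵖ where
  Conflation S := E.Conflation S.unop
  isWeakShortExact S h := by
    obtain ⟨⟨h₁⟩, ⟨h₂⟩⟩ := E.isWeakShortExact _ h
    exact ⟨⟨CokernelCofork.IsColimit.ofπOp _ _ h₂⟩, ⟨KernelFork.IsLimit.ofιOp _ _ h₁⟩⟩
  of_iso S S' := by
    rintro ⟨e⟩ h
    exact E.of_iso _ _ ⟨⟨ShortComplex.unopMap e.inv, ShortComplex.unopMap e.hom,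
      congr_arg ShortComplex.unopMap e.hom_inv_id, congr_arg ShortComplex.unopMap e.inv_hom_id⟩⟩ h
  directSum_mem S S' h h' :=
    E.of_iso _ _ ((nonempty_directSum_unop_iso S S').map Iso.symm) (E.directSum_mem _ _ h h')
  of_directSum S S' h :=
    E.of_directSum _ _ (E.of_iso _ _ (nonempty_directSum_unop_iso S S') h)
  id_inflation X := by
    obtain ⟨Z, d, w, h⟩ := E.id_deflation X.unop
    exact ⟨_, d.op, Quiver.Hom.unop_inj w, h⟩
  id_deflation X := by
    obtain ⟨Z, d, w, h⟩ := E.id_inflation X.unop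
    exact ⟨_, d.op, Quiver.Hom.unop_inj w, h⟩
  comp_inflation := by
    rintro X Y Z f g ⟨_, a, wa, ha⟩ ⟨_, b, wb, hb⟩
    obtain ⟨Z, d, w, h⟩ := E.comp_deflation g.unop f.unop
      ⟨_, b.unop, congr_arg Quiver.Hom.unop wb, hb⟩ ⟨_, a.unop, congr_arg Quiver.Hom.unop wa, ha⟩
    exact ⟨_, d.op, Quiver.Hom.unop_inj w, h⟩
  comp_deflation := by
    rintro X Y Z f g ⟨_, a, wa, ha⟩ ⟨_, b, wb, hb⟩
    obtain ⟨Z, d, w, h⟩ := E.comp_inflation g.unop f.unop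
      ⟨_, b.unop, congr_arg Quiver.Hom.unop wb, hb⟩ ⟨_, a.unop, congr_arg Quiver.Hom.unop wa, ha⟩
    exact ⟨_, d.op, Quiver.Hom.unop_inj w, h⟩
  pullback_deflation := by
    rintro Y Z Z' d f ⟨_, a, wa, ha⟩
    obtain ⟨Y', f', d', sq, ⟨_, b, w, h⟩⟩ := E.pushout_inflation d.unop f.unop
      ⟨_, a.unop, congr_arg Quiver.Hom.unop wa, ha⟩
    exact ⟨_, f'.op, d'.op, sq.flip.op, ⟨_, b.op, Quiver.Hom.unop_inj w, h⟩⟩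
  pushout_inflation := by
    rintro X X' Y i g ⟨_, a, wa, ha⟩
    obtain ⟨Y', f', d', sq, ⟨_, b, w, h⟩⟩ := E.pullback_deflation i.unop g.unop
      ⟨_, a.unop, congr_arg Quiver.Hom.unop wa, ha⟩
    exact ⟨_, f'.op, d'.op, sq.flip.op, ⟨_, b.op, Quiver.Hom.unop_inj w, h⟩⟩

theorem SES.op {X Y Z : C} {i : X ⟶ Y} {d : Y ⟶ Z} (h : E.SES i d) : E.op.SES d.op i.op :=
  ⟨Quiver.Hom.unop_inj h.1, h.2⟩

theorem SES.unop {X Y Z : Cᵒᵖ} {i : X ⟶ Y} {d : Y ⟶ Z} (h : E.op.SES i d) :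
    E.SES d.unop i.unop :=
  ⟨congr_arg Quiver.Hom.unop h.1, h.2⟩

theorem SES.pullback {X Y Z : C} {i : X ⟶ Y} {d : Y ⟶ Z} (h : E.SES i d) {Y' Z' : C}
    {f' : Y' ⟶ Y} {d' : Y' ⟶ Z'} {f : Z' ⟶ Z} (sq : IsPullback f' d' d f) :
    ∃ i', E.SES i' d' ∧ i' ≫ f' = i := by
  obtain ⟨i', h', w⟩ := h.op.pushout sq.flip.op
  exact ⟨i'.unop, h'.unop, congr_arg Quiver.Hom.unop w⟩

variable (E) in
theorem exists_ses_biprod_desc_id {X Y : C} (f : X ⟶ Y) :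
    ∃ i : X ⟶ X ⊞ Y, E.SES i (biprod.desc f (𝟙 Y)) := by
  -- With projections `biprod.fst` and `biprod.desc f (𝟙 Y)`, `X ⊞ Y` is still a product of `X` and
  -- `Y`.
  have sq : IsPullback (biprod.fst : X ⊞ Y ⟶ X) (biprod.desc f (𝟙 Y)) (0 : X ⟶ 0) (0 : Y ⟶ 0) := by
    refine ⟨⟨by simp⟩, ⟨PullbackCone.IsLimit.mk _
      (fun s => biprod.lift s.fst (s.snd - s.fst ≫ f)) ?_ ?_ ?_⟩⟩
    · intro s; simp
    · intro s; simp
    · intro s m h₁ h₂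
      ext
      · simpa using h₁
      · simp [← h₁, ← h₂, biprod.desc_eq]
  obtain ⟨i, h, -⟩ := (E.ses_id X).pullback sq
  exact ⟨i, h⟩

/-- `(f, d) : A ⊞ Y ⟶ Z` is a deflation if `d` is one. -/
theorem SES.isDeflation_biprod_desc {X Y Z A : C} {i : X ⟶ Y} {d : Y ⟶ Z} (h : E.SES i d)
    (f : A ⟶ Z) : IsDeflation E.Conflation (biprod.desc f d) := by
  obtain ⟨j, hj⟩ := E.exists_ses_biprod_desc_id f
  obtain ⟨_, k, w, hk⟩ := E.id_deflation A
  have hk : E.SES k (𝟙 A) := ⟨w, hk⟩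
  have := E.comp_deflation _ _ (hk.biprod h).deflation hj.deflation
  rwa [show biprod.map (𝟙 A) d ≫ biprod.desc f (𝟙 Z) = biprod.desc f d by ext <;> simp] at this

/-! ### Additive subcategories and single cotorsion pairs. -/

namespace IsAdditiveSubcategory

variable {P : ObjectProperty C}

theorem of_iso (hP : IsAdditiveSubcategory P) {X Y : C} (e : X ≅ Y) (hX : P X) : P Y :=
  hP.summand Y 0 X hX ⟨e ≪≫ isoBiprodZero (isZero_zero C)⟩

theorem of_isZero (hP : IsAdditiveSubcategory P) {X : C} (hX : IsZero X) : P X :=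
  hP.of_iso ((isZero_zero C).iso hX) hP.zero

theorem op (hP : IsAdditiveSubcategory P) : IsAdditiveSubcategory P.op where
  zero := hP.of_isZero (isZero_zero Cᵒᵖ).unop
  biprod X Y hX hY := hP.of_iso (unopBiprodIso X Y).symm (hP.biprod _ _ hX hY)
  summand X Y Z hZ := by
    rintro ⟨e⟩
    exact hP.summand X.unop Y.unop Z.unop hZ ⟨e.unop.symm ≪≫ unopBiprodIso X Y⟩

theorem left_of_section (hP : IsAdditiveSubcategory P) {E : ExactStructure C} {X Y Z : C}
    {i : X ⟶ Y} {d : Y ⟶ Z} (h : E.SES i d) {s : Z ⟶ Y} (hs : s ≫ d = 𝟙 Z) (hY : P Y) : P X := by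
  obtain ⟨l, hl⟩ := h.exists_lift (𝟙 Y - d ≫ s) (by simp [hs])
  have := h.mono
  refine hP.summand X Z Y hY ⟨⟨biprod.lift l d, biprod.desc i s, ?_, ?_⟩⟩
  · simp [biprod.lift_desc, hl]
  · have h₁ : i ≫ l = 𝟙 X := by
      rw [← cancel_mono i, Category.assoc, hl]
      simp [reassoc_of% h.zero]
    have h₂ : s ≫ l = 0 := by
      rw [← cancel_mono i, Category.assoc, hl]
      simp [reassoc_of% hs]
    ext <;> simp [h₁, h₂, hs, h.zero]

end IsAdditiveSubcategory

/-- The sequence is equivalent to the split extension, whose section `biprod.inr` is transported. -/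
theorem SES.exists_section {X Y Z : C} {i : X ⟶ Y} {d : Y ⟶ Z} (h : E.SES i d)
    (hE : Subsingleton (E.Ext1 Z X)) : ∃ s, s ≫ d = 𝟙 Z := by
  obtain ⟨j, hj⟩ := E.exists_ses_biprod_desc_id (0 : X ⟶ Z)
  have := hE.elim (Quotient.mk (E.extensionSetoid Z X) ⟨_, j, _, hj.1, hj.2⟩)
    (Quotient.mk (E.extensionSetoid Z X) ⟨_, i, d, h.1, h.2⟩)
  obtain ⟨e, -, he⟩ := Quotient.exact this
  dsimp at e he
  exact ⟨biprod.inr ≫ e.hom, by simp [he]⟩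

namespace IsCotorsionPair

variable {U V : ObjectProperty C}

theorem op (h : E.IsCotorsionPair U V) : E.op.IsCotorsionPair V.op U.op where
  left := h.right.op
  right := h.left.op
  ext_eq_zero X Y hX hY := by
    have := h.ext_eq_zero _ _ hY hX
    refine ⟨fun a b => ?_⟩
    obtain ⟨A, rfl⟩ := Quotient.exists_rep a
    obtain ⟨B, rfl⟩ := Quotient.exists_rep b
    have hA : E.SES A.d.unop A.i.unop := SES.unop ⟨A.w, A.conflation⟩
    have hB : E.SES B.d.unop B.i.unop := SES.unop ⟨B.w, B.conflation⟩
    have := this.elim (Quotient.mk (E.extensionSetoid _ _) ⟨_, _, _, hA.1, hA.2⟩)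
      (Quotient.mk (E.extensionSetoid _ _) ⟨_, _, _, hB.1, hB.2⟩)
    obtain ⟨e, h₁, h₂⟩ := Quotient.exact this
    dsimp at e h₁ h₂
    refine Quotient.sound ⟨e.symm.op, ?_, ?_⟩
    · apply Quiver.Hom.unop_inj
      simp [← h₂]
    · apply Quiver.Hom.unop_inj
      simp [← h₁]
  resolution X := by
    obtain ⟨A, B, hA, hB, i, d, w, hc⟩ := h.coresolution X.unop
    have hc : E.SES i d := ⟨w, hc⟩
    exact ⟨_, _, hB, hA, _, _, hc.op.1, hc.op.2⟩
  coresolution X := by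
    obtain ⟨A, B, hA, hB, i, d, w, hc⟩ := h.resolution X.unop
    have hc : E.SES i d := ⟨w, hc⟩
    exact ⟨_, _, hB, hA, _, _, hc.op.1, hc.op.2⟩

/-- The pullback of the sequence along `f` is an extension of `A` by `X`, hence splits. -/
theorem exists_lift (h : E.IsCotorsionPair U V) {X Y Z A : C} {i : X ⟶ Y} {d : Y ⟶ Z}
    (hs : E.SES i d) (hX : V X) (hA : U A) (f : A ⟶ Z) : ∃ g, g ≫ d = f := by
  obtain ⟨Y', f', d', sq, -⟩ := E.pullback_deflation d f hs.deflation
  obtain ⟨i', h', -⟩ := hs.pullback sq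
  obtain ⟨s, hs⟩ := h'.exists_section (h.ext_eq_zero _ _ hA hX)
  exact ⟨s ≫ f', by rw [Category.assoc, sq.w, reassoc_of% hs]⟩

theorem exists_extension (h : E.IsCotorsionPair U V) {X Y Z A : C} {i : X ⟶ Y} {d : Y ⟶ Z}
    (hs : E.SES i d) (hZ : U Z) (hA : V A) (f : X ⟶ A) : ∃ g, i ≫ g = f := by
  obtain ⟨g, hg⟩ := h.op.exists_lift hs.op hZ hA f.op
  exact ⟨g.unop, congr_arg Quiver.Hom.unop hg⟩

/-- For `Y ↣ B ↠ A` with `B` in `V` and `A` in `U`, the identity of `A` lifts in two stages, to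
`B/X` (kernel `Z`) and to `B` (kernel `X`). Thus `Y` is a summand of `B`. -/
theorem right_of_ses (h : E.IsCotorsionPair U V) {X Y Z : C} {i : X ⟶ Y} {d : Y ⟶ Z}
    (hs : E.SES i d) (hX : V X) (hZ : V Z) : V Y := by
  obtain ⟨A, B, hA, hB, j, e, w, hc⟩ := h.coresolution Y
  have hc : E.SES j e := ⟨w, hc⟩
  obtain ⟨Q, p, k, q, h₁, h₂, hpq, -⟩ := hs.comp hc
  obtain ⟨s, hs⟩ := h.exists_lift h₂ hZ hA (𝟙 A)
  obtain ⟨t, ht⟩ := h.exists_lift h₁ hX hA s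
  exact h.right.left_of_section hc (s := t) (by rw [← hpq, reassoc_of% ht, hs]) hB

theorem left_of_ses (h : E.IsCotorsionPair U V) {X Y Z : C} {i : X ⟶ Y} {d : Y ⟶ Z}
    (hs : E.SES i d) (hX : U X) (hZ : U Z) : U Y :=
  h.op.right_of_ses hs.op hZ hX

end IsCotorsionPair

/-! ### Twin cotorsion pairs, their duals, and maps through `W`. -/

namespace TwinCotorsionPair

variable (P : E.TwinCotorsionPair)

/-- As `S ⊆ U`, the sequence `X ↣ T ↠ S` splits for `X` in `V`. -/
theorem V_le_T : P.V ≤ P.T := by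
  intro X hX
  obtain ⟨S, T, hS, hT, i, d, w, hc⟩ := P.cotorsion_ST.coresolution X
  have hc : E.SES i d := ⟨w, hc⟩
  obtain ⟨s, hs⟩ := P.cotorsion_UV.exists_lift hc hX (P.le _ hS) (𝟙 S)
  exact P.cotorsion_ST.right.left_of_section hc hs hT

/-- The opposite twin cotorsion pair. -/
noncomputable def op : E.op.TwinCotorsionPair where
  S := P.V.op
  T := P.U.op
  U := P.T.op
  V := P.S.op
  cotorsion_ST := P.cotorsion_UV.op
  cotorsion_UV := P.cotorsion_ST.op
  le _ hX := P.V_le_T _ hX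

/-- The morphisms that factor through an object of `W`. -/
def Null {X Y : C} (f : X ⟶ Y) : Prop :=
  ∃ (Z : C) (_ : P.W Z) (a : X ⟶ Z) (b : Z ⟶ Y), f = a ≫ b

variable {P}

theorem W_op_iff {X : Cᵒᵖ} : P.op.W X ↔ P.W X.unop := and_comm

theorem Bplus_op_iff {X : Cᵒᵖ} : P.op.Bplus X ↔ P.Bminus X.unop := by
  constructor
  · rintro ⟨A, B, hA, hB, i, d, w, hc⟩
    have hc : E.op.SES i d := ⟨w, hc⟩
    exact ⟨_, _, W_op_iff.1 hA, hB, _, _, hc.unop⟩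
  · rintro ⟨A, B, hA, hB, i, d, w, hc⟩
    have hc : E.SES i d := ⟨w, hc⟩
    exact ⟨_, _, W_op_iff.2 hA, hB, _, _, hc.op⟩

theorem Bminus_op_iff {X : Cᵒᵖ} : P.op.Bminus X ↔ P.Bplus X.unop := by
  constructor
  · rintro ⟨A, B, hA, hB, i, d, w, hc⟩
    have hc : E.op.SES i d := ⟨w, hc⟩
    exact ⟨_, _, W_op_iff.1 hA, hB, _, _, hc.unop⟩
  · rintro ⟨A, B, hA, hB, i, d, w, hc⟩
    have hc : E.SES i d := ⟨w, hc⟩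
    exact ⟨_, _, W_op_iff.2 hA, hB, _, _, hc.op⟩

theorem H_op_iff {X : Cᵒᵖ} : P.op.H X ↔ P.H X.unop :=
  (and_congr Bplus_op_iff Bminus_op_iff).trans and_comm

theorem null_op_iff {X Y : Cᵒᵖ} {f : X ⟶ Y} : P.op.Null f ↔ P.Null f.unop := by
  constructor
  · rintro ⟨Z, hZ, a, b, rfl⟩
    exact ⟨_, W_op_iff.1 hZ, b.unop, a.unop, rfl⟩
  · rintro ⟨Z, hZ, a, b, h⟩
    exact ⟨_, W_op_iff.2 hZ, b.op, a.op, Quiver.Hom.unop_inj h⟩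

theorem Null.comp_left {X Y Z : C} {g : Y ⟶ Z} (hg : P.Null g) (f : X ⟶ Y) : P.Null (f ≫ g) := by
  obtain ⟨W, hW, a, b, rfl⟩ := hg
  exact ⟨W, hW, f ≫ a, b, by simp⟩

theorem Null.add {X Y : C} {f g : X ⟶ Y} (hf : P.Null f) (hg : P.Null g) : P.Null (f + g) := by
  obtain ⟨W, hW, a, b, rfl⟩ := hf
  obtain ⟨W', hW', a', b', rfl⟩ := hg
  obtain ⟨Z, hZ, c, d, h⟩ := P.rel_add (a ≫ b) 0 (a' ≫ b') 0
    ⟨W, hW, a, b, sub_zero _⟩ ⟨W', hW', a', b', sub_zero _⟩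
  exact ⟨Z, hZ, c, d, by rw [← h]; simp⟩

theorem Null.neg {X Y : C} {f : X ⟶ Y} (hf : P.Null f) : P.Null (-f) := by
  obtain ⟨W, hW, a, b, rfl⟩ := hf
  exact ⟨W, hW, a, -b, by simp⟩

theorem null_of_W_source {X Y : C} (hX : P.W X) (f : X ⟶ Y) : P.Null f :=
  ⟨X, hX, 𝟙 X, f, by simp⟩

theorem null_zero {X Y : C} : P.Null (0 : X ⟶ Y) :=
  ⟨0, ⟨P.cotorsion_ST.right.zero, P.cotorsion_UV.left.zero⟩, 0, 0, by simp⟩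

/-! ### Closure properties of `Bminus` and `H`. -/

/-- A middle term in `U` can be enlarged to one in `W`: its embedding into `T` has cokernel in `S ⊆
U`, so the target stays in `U`, and the new cokernel is an extension of objects of `S`. -/
theorem Bminus_of_ses_U {X Y Z : C} {i : X ⟶ Y} {d : Y ⟶ Z} (h : E.SES i d) (hY : P.U Y)
    (hZ : P.S Z) : P.Bminus X := by
  obtain ⟨S, T, hS, hT, j, e, w, hc⟩ := P.cotorsion_ST.coresolution Y
  have hc : E.SES j e := ⟨w, hc⟩
  obtain ⟨Q, p, k, q, h₁, h₂, -⟩ := h.comp hc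
  exact ⟨T, Q, ⟨hT, P.cotorsion_UV.left_of_ses hc hY (P.le _ hS)⟩,
    P.cotorsion_ST.left_of_ses h₂ hZ hS, _, _, h₁⟩

theorem Bminus_left {X Y Z : C} {i : X ⟶ Y} {d : Y ⟶ Z} (h : E.SES i d) (hY : P.Bminus Y)
    (hZ : P.S Z) : P.Bminus X := by
  obtain ⟨W, S, hW, hS, j, e, hc⟩ := hY
  have hc : E.SES j e := hc
  obtain ⟨Q, p, k, q, h₁, h₂, -⟩ := h.comp hc
  exact Bminus_of_ses_U h₁ hW.2 (P.cotorsion_ST.left_of_ses h₂ hZ hS)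

theorem Bminus_middle {X Y Z : C} {i : X ⟶ Y} {d : Y ⟶ Z} (h : E.SES i d) (hX : P.Bminus X)
    (hZ : P.S Z) : P.Bminus Y := by
  obtain ⟨W, S, hW, hS, j, e, hc⟩ := hX
  have hc : E.SES j e := hc
  -- `Q` is an extension of `Z` by `W`, hence in `U`, and `Y ↣ Q` has cokernel `S`.
  obtain ⟨Q, k, l, sq, -⟩ := E.pushout_inflation i j h.inflation
  obtain ⟨d', h₁, -⟩ := h.pushout sq
  obtain ⟨e', h₂, -⟩ := hc.pushout sq.flip
  exact Bminus_of_ses_U h₂ (P.cotorsion_UV.left_of_ses h₁ hW.2 (P.le _ hZ)) hS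

theorem W_le_Bminus : P.W ≤ P.Bminus := fun X hX =>
  ⟨X, _, hX, P.cotorsion_ST.left.zero, _, _, E.ses_id X⟩

theorem W_le_H : P.W ≤ P.H := fun X hX =>
  ⟨Bminus_op_iff.1 (W_le_Bminus (P := P.op) (Opposite.op X) (W_op_iff.2 hX)), W_le_Bminus X hX⟩

theorem Bminus_biprod {X Y : C} (hX : P.Bminus X) (hY : P.Bminus Y) : P.Bminus (X ⊞ Y) := by
  obtain ⟨W, S, hW, hS, i, d, hc⟩ := hX
  obtain ⟨W', S', hW', hS', i', d', hc'⟩ := hY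
  have hc : E.SES i d := hc
  have hc' : E.SES i' d' := hc'
  exact ⟨W ⊞ W', S ⊞ S', ⟨P.cotorsion_ST.right.biprod _ _ hW.1 hW'.1,
    P.cotorsion_UV.left.biprod _ _ hW.2 hW'.2⟩, P.cotorsion_ST.left.biprod _ _ hS hS', _, _,
    hc.biprod hc'⟩

theorem Bplus_biprod {X Y : C} (hX : P.Bplus X) (hY : P.Bplus Y) : P.Bplus (X ⊞ Y) := by
  obtain ⟨W, S, hW, hS, i, d, hc⟩ := hX
  obtain ⟨W', S', hW', hS', i', d', hc'⟩ := hY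
  have hc : E.SES i d := hc
  have hc' : E.SES i' d' := hc'
  exact ⟨W ⊞ W', S ⊞ S', ⟨P.cotorsion_ST.right.biprod _ _ hW.1 hW'.1,
    P.cotorsion_UV.left.biprod _ _ hW.2 hW'.2⟩, P.cotorsion_UV.right.biprod _ _ hS hS', _, _,
    hc.biprod hc'⟩

theorem H_biprod {X Y : C} (hX : P.H X) (hY : P.H Y) : P.H (X ⊞ Y) :=
  ⟨Bplus_biprod hX.1 hY.1, Bminus_biprod hX.2 hY.2⟩

/-! ### Reflection into `Bplus` and cokernels modulo `W`. -/

/-- An inflation with cokernel in `S` is an epimorphism modulo `W`, as tested on `Bplus`. -/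
theorem null_of_ses_comp {X Y Z A : C} {i : X ⟶ Y} {d : Y ⟶ Z} (h : E.SES i d) (hZ : P.S Z)
    (hA : P.Bplus A) {g : Y ⟶ A} (hg : P.Null (i ≫ g)) : P.Null g := by
  obtain ⟨W, hW, a, b, hab⟩ := hg
  obtain ⟨a', rfl⟩ := P.cotorsion_ST.exists_extension h hZ hW.1 a
  obtain ⟨l, hl⟩ := h.exists_desc (g - a' ≫ b) (by simp [hab])
  obtain ⟨W', V, hW', hV, j, e, hc⟩ := hA
  obtain ⟨m, rfl⟩ := P.cotorsion_UV.exists_lift hc hV (P.le _ hZ) l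
  rw [← sub_add_cancel g (a' ≫ b), ← hl]
  exact .add ⟨W', hW', d ≫ m, e, by simp⟩ ⟨W, hW, a', b, rfl⟩

variable (P) in
/-- Every object embeds into an object of `Bplus` with cokernel in `S`, universally. -/
theorem exists_reflection (M : C) :
    ∃ (D S : C) (i : M ⟶ D) (d : D ⟶ S), E.SES i d ∧ P.S S ∧ P.Bplus D ∧
      ∀ ⦃Y : C⦄, P.Bplus Y → ∀ g : M ⟶ Y, ∃ h, i ≫ h = g := by
  obtain ⟨U, V, hU, hV, v, u, hc⟩ := P.cotorsion_UV.resolution M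
  have hc : E.SES v u := hc
  obtain ⟨S, T, hS, hT, j, e, hc'⟩ := P.cotorsion_ST.coresolution U
  have hc' : E.SES j e := hc'
  obtain ⟨D, p, k, q, h₁, h₂, -, sq⟩ := hc.comp hc'
  have hT' : P.U T := P.cotorsion_UV.left_of_ses hc' hU (P.le _ hS)
  refine ⟨D, S, k, q, h₂, hS, ⟨T, V, ⟨hT, hT'⟩, hV, _, _, h₁⟩, ?_⟩
  rintro Y ⟨W, V', hW, hV', a, b, hY⟩ g
  -- The map from `U` lifts to `W` and then extends over `T`; with `g` it descends to the pushout
  -- `D`.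
  obtain ⟨l, hl⟩ := P.cotorsion_UV.exists_lift hY hV' hU (u ≫ g)
  obtain ⟨m, rfl⟩ := P.cotorsion_ST.exists_extension hc' hS hW.1 l
  exact ⟨sq.desc g (m ≫ b) (by simpa using hl.symm), by simp⟩

variable (P) in
/-- `c` is a cokernel of `f` in the heart. -/
structure IsHeartCokernel {A B D : C} (f : A ⟶ B) (c : B ⟶ D) : Prop where
  zero : P.Null (f ≫ c)
  exists_desc : ∀ ⦃Y : C⦄, P.H Y → ∀ g : B ⟶ Y, P.Null (f ≫ g) → ∃ h, P.Null (c ≫ h - g)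
  epi : ∀ ⦃Y : C⦄, P.H Y → ∀ h : D ⟶ Y, P.Null (c ≫ h) → P.Null h

variable (P) in
/-- Any base change of `c` in the heart is an epimorphism, expressed without pullbacks. -/
def IsStablyEpi {B D : C} (c : B ⟶ D) : Prop :=
  ∀ ⦃B' : C⦄, P.H B' → ∀ γ : B' ⟶ D, ∃ (X : C) (_ : P.H X) (x₁ : X ⟶ B') (x₂ : X ⟶ B),
    P.Null (x₁ ≫ γ - x₂ ≫ c) ∧ ∀ ⦃Y : C⦄, P.H Y → ∀ h : B' ⟶ Y, P.Null (x₁ ≫ h) → P.Null h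

theorem isStablyEpi_of_ses {B D S : C} {c : B ⟶ D} {d : D ⟶ S} (h : E.SES c d) (hS : P.S S)
    (hB : P.Bplus B) (hD : P.Bplus D) : P.IsStablyEpi c := by
  intro B' hB' γ
  obtain ⟨W, V, hW, hV, i, w, hc⟩ := id hD
  have hc : E.SES i w := hc
  -- `X` acts as the pullback of `c` along the deflation `(γ, w)`, and `l` is its projection to `B`.
  obtain ⟨X, j, h₀, hj⟩ := E.comp_deflation _ _ (hc.isDeflation_biprod_desc γ) h.deflation
  have hj : E.SES j (biprod.desc γ w ≫ d) := ⟨h₀, hj⟩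
  obtain ⟨l, hl⟩ := h.exists_lift (j ≫ biprod.desc γ w) (by rw [Category.assoc, hj.zero])
  have hX : P.Bminus X := Bminus_left hj (Bminus_biprod hB'.2 (W_le_Bminus _ hW)) hS
  obtain ⟨X', S', k, q, hk, hS', hX', hext⟩ := P.exists_reflection X
  obtain ⟨x₁, hx₁⟩ := hext hB'.1 (j ≫ biprod.fst)
  obtain ⟨x₂, rfl⟩ := hext hB l
  refine ⟨X', ⟨hX', Bminus_middle hk hX hS'⟩, x₁, x₂, null_of_ses_comp hk hS' hD ?_, ?_⟩
  · have : k ≫ (x₁ ≫ γ - x₂ ≫ c) = -((j ≫ biprod.snd) ≫ w) := by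
      rw [Preadditive.comp_sub, reassoc_of% hx₁, ← Category.assoc k, hl, biprod.desc_eq]
      simp
    rw [this]
    exact .neg ⟨W, hW, _, _, rfl⟩
  · intro Y hY h hh
    -- The inclusion `j` of `X` into `B' ⊞ W` has cokernel in `S`, so it can be cancelled.
    have h₁ : P.Null (biprod.fst ≫ h : B' ⊞ W ⟶ Y) :=
      null_of_ses_comp hj hS hY.1 (by simpa [reassoc_of% hx₁] using hh.comp_left k)
    simpa using h₁.comp_left biprod.inl

theorem exists_isHeartCokernel {A B : C} (hA : P.H A) (hB : P.H B) (f : A ⟶ B) :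
    ∃ (D : C) (_ : P.H D) (c : B ⟶ D), P.IsHeartCokernel f c ∧ P.IsStablyEpi c := by
  obtain ⟨W, S, hW, hS, i, d, hc⟩ := hA.2
  have hc : E.SES i d := hc
  obtain ⟨M, g', j, sq, -⟩ := E.pushout_inflation i f hc.inflation
  obtain ⟨e, hj, -⟩ := hc.pushout sq
  obtain ⟨D, S', k, q, hk, hS', hD, hext⟩ := P.exists_reflection M
  obtain ⟨Q, p, a, b, h₁, h₂, -⟩ := hj.comp hk
  have hQ := P.cotorsion_ST.left_of_ses h₂ hS hS'
  have hD : P.H D := ⟨hD, Bminus_middle h₁ hB.2 hQ⟩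
  refine ⟨D, hD, j ≫ k, ⟨⟨W, hW, i, g' ≫ k, by simp [sq.w_assoc]⟩, ?_,
    fun Y hY h => null_of_ses_comp h₁ hQ hY.1⟩, isStablyEpi_of_ses h₁ hQ hB.1 hD.1⟩
  rintro Y hY g ⟨W', hW', a, b, hg⟩
  -- Extending `a` over `W` makes `g` factor through the pushout on the nose, not only modulo `W`.
  obtain ⟨a', rfl⟩ := P.cotorsion_ST.exists_extension hc hS hW'.1 a
  obtain ⟨h, hh⟩ := hext hY.1 (sq.desc (a' ≫ b) g (by simp [hg]))
  exact ⟨h, by simpa [hh] using null_zero⟩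

/-! ### Passage to the quotient category. -/

/-- The class in the heart of a morphism between objects of `H`. -/
def heartMap {X Y : P.Heart} (f : X.obj.as ⟶ Y.obj.as) : X ⟶ Y :=
  ObjectProperty.homMk ((CategoryTheory.Quotient.functor P.rel).map f)

variable (P) in
/-- An object of `H`, as an object of the heart. -/
def heartObj (X : C) (hX : P.H X) : P.Heart := ⟨⟨X⟩, hX⟩

theorem heartMap_surjective {X Y : P.Heart} :
    Function.Surjective (heartMap : (X.obj.as ⟶ Y.obj.as) → (X ⟶ Y)) := by
  rintro ⟨f⟩
  obtain ⟨g, rfl⟩ := (CategoryTheory.Quotient.functor P.rel).map_surjective f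
  exact ⟨g, rfl⟩

theorem heartMap_id (X : P.Heart) : heartMap (𝟙 X.obj.as) = 𝟙 X := rfl

theorem heartMap_comp {X Y Z : P.Heart} (f : X.obj.as ⟶ Y.obj.as) (g : Y.obj.as ⟶ Z.obj.as) :
    (heartMap f : X ⟶ Y) ≫ (heartMap g : Y ⟶ Z) = heartMap (f ≫ g) := rfl

theorem heartMap_eq_iff {X Y : P.Heart} {f g : X.obj.as ⟶ Y.obj.as} :
    (heartMap f : X ⟶ Y) = heartMap g ↔ P.Null (f - g) := by
  refine ⟨fun h => ?_, fun h => ?_⟩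
  · exact (CategoryTheory.Quotient.functor_map_eq_iff P.rel f g).1 (congr_arg (·.hom) h)
  · exact ObjectProperty.hom_ext _ ((CategoryTheory.Quotient.functor_map_eq_iff P.rel f g).2 h)

theorem heartMap_eq_zero_iff {X Y : P.Heart} {f : X.obj.as ⟶ Y.obj.as} :
    (heartMap f : X ⟶ Y) = 0 ↔ P.Null f := by
  rw [show (0 : X ⟶ Y) = heartMap 0 from rfl, heartMap_eq_iff, sub_zero]

theorem epi_heartMap {X Y : P.Heart} {f : X.obj.as ⟶ Y.obj.as}
    (hf : ∀ ⦃Z : C⦄, P.H Z → ∀ h : Y.obj.as ⟶ Z, P.Null (f ≫ h) → P.Null h) :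
    Epi (heartMap f : X ⟶ Y) := by
  refine Preadditive.epi_of_cancel_zero _ fun {Z} g hg => ?_
  obtain ⟨g, rfl⟩ := heartMap_surjective g
  rw [heartMap_comp, heartMap_eq_zero_iff] at hg
  exact heartMap_eq_zero_iff.2 (hf Z.property g hg)

theorem mono_heartMap {X Y : P.Heart} {f : X.obj.as ⟶ Y.obj.as}
    (hf : ∀ ⦃Z : C⦄, P.H Z → ∀ h : Z ⟶ X.obj.as, P.Null (h ≫ f) → P.Null h) :
    Mono (heartMap f : X ⟶ Y) := by
  refine Preadditive.mono_of_cancel_zero _ fun {Z} g hg => ?_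
  obtain ⟨g, rfl⟩ := heartMap_surjective g
  rw [heartMap_comp, heartMap_eq_zero_iff] at hg
  exact heartMap_eq_zero_iff.2 (hf Z.property g hg)

theorem hasZeroObject_heart : HasZeroObject P.Heart :=
  ⟨⟨P.heartObj 0 (W_le_H _ ⟨P.cotorsion_ST.right.zero, P.cotorsion_UV.left.zero⟩), by
    rw [IsZero.iff_id_eq_zero, ← heartMap_id, heartMap_eq_zero_iff]
    exact null_of_W_source ⟨P.cotorsion_ST.right.zero, P.cotorsion_UV.left.zero⟩ _⟩⟩

theorem hasBinaryBiproducts_heart : HasBinaryBiproducts P.Heart where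
  has_binary_biproduct X Y := by
    have h0 {A B : P.Heart} : (0 : A ⟶ B) = heartMap 0 := rfl
    exact hasBinaryBiproduct_of_total
      { pt := P.heartObj (X.obj.as ⊞ Y.obj.as) (H_biprod X.property Y.property)
        fst := heartMap biprod.fst
        snd := heartMap biprod.snd
        inl := heartMap biprod.inl
        inr := heartMap biprod.inr
        inl_fst := congr_arg heartMap biprod.inl_fst
        inl_snd := congr_arg heartMap biprod.inl_snd
        inr_fst := congr_arg heartMap biprod.inr_fst
        inr_snd := congr_arg heartMap biprod.inr_snd }
      (congr_arg heartMap biprod.total)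

theorem IsHeartCokernel.nonempty_isColimit {A B D : P.Heart} {f : A.obj.as ⟶ B.obj.as}
    {c : B.obj.as ⟶ D.obj.as} (h : P.IsHeartCokernel f c) :
    Nonempty (IsColimit (CokernelCofork.ofπ (f := (heartMap f : A ⟶ B)) (heartMap c : B ⟶ D)
      (heartMap_eq_zero_iff.2 h.zero))) := by
  have := epi_heartMap (X := B) (Y := D) h.epi
  have hd {Y : P.Heart} (g : B ⟶ Y) (hg : (heartMap f : A ⟶ B) ≫ g = 0) :
      ∃ l : D ⟶ Y, (heartMap c : B ⟶ D) ≫ l = g := by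
    obtain ⟨g, rfl⟩ := heartMap_surjective g
    obtain ⟨l, hl⟩ := h.exists_desc Y.property g (heartMap_eq_zero_iff.1 hg)
    exact ⟨heartMap l, heartMap_eq_iff.2 hl⟩
  exact ⟨CokernelCofork.IsColimit.ofπ' _ _ fun {Y} g hg => ⟨_, (hd g hg).choose_spec⟩⟩

/-! ### Kernels, by duality. -/

variable (P) in
/-- `k` is a kernel of `f` in the heart. -/
structure IsHeartKernel {K A B : C} (k : K ⟶ A) (f : A ⟶ B) : Prop where
  zero : P.Null (k ≫ f)
  exists_lift : ∀ ⦃Y : C⦄, P.H Y → ∀ g : Y ⟶ A, P.Null (g ≫ f) → ∃ h, P.Null (h ≫ k - g)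
  mono : ∀ ⦃Y : C⦄, P.H Y → ∀ h : Y ⟶ K, P.Null (h ≫ k) → P.Null h

variable (P) in
/-- Any cobase change of `k` in the heart is a monomorphism, expressed without pushouts. -/
def IsStablyMono {K A : C} (k : K ⟶ A) : Prop :=
  ∀ ⦃B : C⦄, P.H B → ∀ γ : K ⟶ B, ∃ (X : C) (_ : P.H X) (x₁ : B ⟶ X) (x₂ : A ⟶ X),
    P.Null (γ ≫ x₁ - k ≫ x₂) ∧ ∀ ⦃Y : C⦄, P.H Y → ∀ h : Y ⟶ B, P.Null (h ≫ x₁) → P.Null h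

theorem exists_isHeartKernel {A B : C} (hA : P.H A) (hB : P.H B) (f : A ⟶ B) :
    ∃ (K : C) (_ : P.H K) (k : K ⟶ A), P.IsHeartKernel k f ∧ P.IsStablyMono k := by
  obtain ⟨K, hK, k, ⟨h₁, h₂, h₃⟩, h₄⟩ :=
    exists_isHeartCokernel (P := P.op) (H_op_iff.2 hB) (H_op_iff.2 hA) f.op
  refine ⟨K.unop, H_op_iff.1 hK, k.unop, ⟨null_op_iff.1 h₁, fun Y hY g hg => ?_,
    fun Y hY h hh => null_op_iff.1 (h₃ (H_op_iff.2 hY) h.op (null_op_iff.2 hh))⟩,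
    fun B hB γ => ?_⟩
  · obtain ⟨h, hh⟩ := h₂ (H_op_iff.2 hY) g.op (null_op_iff.2 hg)
    exact ⟨h.unop, null_op_iff.1 hh⟩
  · obtain ⟨X, hX, x₁, x₂, h, h'⟩ := h₄ (H_op_iff.2 hB) γ.op
    exact ⟨X.unop, H_op_iff.1 hX, x₁.unop, x₂.unop, null_op_iff.1 h, fun Y hY g hg =>
      null_op_iff.1 (h' (H_op_iff.2 hY) g.op (null_op_iff.2 hg))⟩

theorem IsHeartKernel.nonempty_isLimit {K A B : P.Heart} {k : K.obj.as ⟶ A.obj.as}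
    {f : A.obj.as ⟶ B.obj.as} (h : P.IsHeartKernel k f) :
    Nonempty (IsLimit (KernelFork.ofι (f := (heartMap f : A ⟶ B)) (heartMap k : K ⟶ A)
      (heartMap_eq_zero_iff.2 h.zero))) := by
  have := mono_heartMap (X := K) (Y := A) h.mono
  have hd {Y : P.Heart} (g : Y ⟶ A) (hg : g ≫ (heartMap f : A ⟶ B) = 0) :
      ∃ l : Y ⟶ K, l ≫ (heartMap k : K ⟶ A) = g := by
    obtain ⟨g, rfl⟩ := heartMap_surjective g
    obtain ⟨l, hl⟩ := h.exists_lift Y.property g (heartMap_eq_zero_iff.1 hg)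
    exact ⟨heartMap l, heartMap_eq_iff.2 hl⟩
  exact ⟨KernelFork.IsLimit.ofι' _ _ fun {Y} g hg => ⟨_, (hd g hg).choose_spec⟩⟩

/-! ### The heart is semi-abelian. -/

variable (P)

theorem isPreabelian_heart : IsPreabelian P.Heart where
  hasZeroObject := hasZeroObject_heart
  hasBinaryBiproducts := hasBinaryBiproducts_heart
  hasKernels := ⟨fun {A B} f => by
    obtain ⟨f, rfl⟩ := heartMap_surjective f
    obtain ⟨K, hK, k, hk, -⟩ := exists_isHeartKernel A.property B.property f
    exact ⟨⟨_, (hk.nonempty_isLimit (K := P.heartObj K hK)).some⟩⟩⟩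
  hasCokernels := ⟨fun {A B} f => by
    obtain ⟨f, rfl⟩ := heartMap_surjective f
    obtain ⟨D, hD, c, hc, -⟩ := exists_isHeartCokernel A.property B.property f
    exact ⟨⟨_, (hc.nonempty_isColimit (D := P.heartObj D hD)).some⟩⟩⟩

theorem isLeftSemiAbelian_heart : IsLeftSemiAbelian P.Heart where
  toIsPreabelian := P.isPreabelian_heart
  epi_of_isPullback := by
    rintro A B' B D α β γ δ sq ⟨Z, f, w, ⟨hδ⟩⟩
    obtain ⟨f, rfl⟩ := heartMap_surjective f
    obtain ⟨D', hD', c, hc, hc'⟩ := exists_isHeartCokernel Z.property B.property f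
    obtain ⟨hcol⟩ := hc.nonempty_isColimit (D := P.heartObj D' hD')
    obtain ⟨φ, hφ⟩ := CokernelCofork.IsColimit.desc' hδ
      (heartMap c : B ⟶ P.heartObj D' hD') (heartMap_eq_zero_iff.2 hc.zero)
    obtain ⟨ψ, hψ⟩ := CokernelCofork.IsColimit.desc' hcol δ w
    dsimp at φ ψ hφ hψ
    have : Epi δ := epi_of_isColimit_cofork hδ
    -- Stability is known for the constructed cokernel `c`, not for `δ`. Its square over `γ ≫ φ`
    -- becomes one over `γ` and `δ` after composing with `ψ`.
    have hφψ : φ ≫ ψ = 𝟙 D := by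
      rw [← cancel_epi δ, reassoc_of% hφ, hψ, Category.comp_id]
    obtain ⟨γ', hγ'⟩ := heartMap_surjective (γ ≫ φ)
    obtain ⟨X, hX, x₁, x₂, h, h'⟩ := hc' B'.property γ'
    have h : (heartMap x₁ : P.heartObj X hX ⟶ B') ≫ γ = (heartMap x₂ : _ ⟶ B) ≫ δ := by
      have h : (heartMap x₁ : P.heartObj X hX ⟶ B') ≫ γ ≫ φ =
          (heartMap x₂ : _ ⟶ B) ≫ (heartMap c : B ⟶ P.heartObj D' hD') := by
        rw [← hγ']
        exact heartMap_eq_iff.2 h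
      simpa [hφψ, hψ] using h =≫ ψ
    have := epi_heartMap (X := P.heartObj X hX) h'
    -- The epimorphism `x₁` factors through the pullback projection `α`.
    exact epi_of_epi_fac (sq.lift_fst _ _ h)

theorem isRightSemiAbelian_heart : IsRightSemiAbelian P.Heart where
  toIsPreabelian := P.isPreabelian_heart
  mono_of_isPushout := by
    rintro K A B D α β γ δ sq ⟨Z, f, w, ⟨hα⟩⟩
    obtain ⟨f, rfl⟩ := heartMap_surjective f
    obtain ⟨K', hK', k, hk, hk'⟩ := exists_isHeartKernel A.property Z.property f
    obtain ⟨hlim⟩ := hk.nonempty_isLimit (K := P.heartObj K' hK')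
    obtain ⟨φ, hφ⟩ := KernelFork.IsLimit.lift' hα
      (heartMap k : P.heartObj K' hK' ⟶ A) (heartMap_eq_zero_iff.2 hk.zero)
    obtain ⟨ψ, hψ⟩ := KernelFork.IsLimit.lift' hlim α w
    dsimp at φ ψ hφ hψ
    have : Mono α := mono_of_isLimit_fork hα
    have hψφ : ψ ≫ φ = 𝟙 K := by
      rw [← cancel_mono α, Category.assoc, hφ, hψ, Category.id_comp]
    obtain ⟨β', hβ'⟩ := heartMap_surjective (φ ≫ β)
    obtain ⟨X, hX, x₁, x₂, h, h'⟩ := hk' B.property β'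
    have h : α ≫ (heartMap x₂ : A ⟶ P.heartObj X hX) = β ≫ (heartMap x₁ : B ⟶ _) := by
      have h : (φ ≫ β) ≫ (heartMap x₁ : B ⟶ P.heartObj X hX) =
          (heartMap k : P.heartObj K' hK' ⟶ A) ≫ (heartMap x₂ : A ⟶ _) := by
        rw [← hβ']
        exact heartMap_eq_iff.2 h
      simpa [reassoc_of% hψφ, reassoc_of% hψ] using (ψ ≫= h).symm
    have := mono_heartMap (Y := P.heartObj X hX) h'
    exact mono_of_mono_fac (sq.inr_desc _ _ h)

end TwinCotorsionPair

end ExactStructure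

end ExactHeart

theorem theorem5 {B : Type u} [Category.{v} B] [Preadditive B] [HasZeroObject B]
    [HasBinaryBiproducts B] (E : ExactHeart.ExactStructure B)
    (hKS : ExactHeart.IsKrullSchmidt B)
    (hProj : E.EnoughProjectives) (hInj : E.EnoughInjectives)
    (P : E.TwinCotorsionPair) :
    ExactHeart.IsSemiAbelian P.Heart :=
  ⟨P.isLeftSemiAbelian_heart, P.isRightSemiAbelian_heart⟩
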